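/- Let $Q$ be a smooth finite-dimensional manifold (without boundary), with projections $\tau_Q:TQ\to Q$, $\pi_Q:T^*Q\to Q$. A discretization map on $Q$ is a smooth map $R_d=(R^1,R^2):U\to Q\times Q$ on an open neighbourhood $U\subset TQ$ of the zero section with $R_d(x,0)=(x,x)$ and $T_{0_x}R^2_x-T_{0_x}R^1_x=\mathrm{Id}_{T_xQ}$ for all $x\in Q$, where $R^a_x=R^a|_{T_xQ\cap U}$. Notation. In induced local coordinates let $\kappa_Q:TTQ\to TTQ$, $\kappa_Q(q,v,\dot q,\dot v)=(q,\dot q,v,\dot v)$ be the canonical involution, let $\alpha_Q:TT^*Q\to T^*TQ$, $\alpha_Q(q,p,\dot q,\dot p)=(q,\dot q,\dot p,p)$ be the canonical isomorphism, and let $\Phi:T^*Q\times T^*Q\to T^*(Q\times Q)$, $\Phi(q_0,p_0;q_1,p_1)=(q_0,q_1,-p_0,p_1)$. The tangent lift of $R_d$ is $R_d^T=TR_d\circ\kappa_Q$, with values in $T(Q\times Q)\equiv TQ\times TQ$. On any open set $V\subset U$ that $R_d$ maps diffeomorphically onto an open subset of $Q\times Q$, write $R_d^{-1}:R_d(V)\to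 V$ for the inverse, $\widehat{R_d}(\alpha_x)=\alpha_x\circ T_{R_d(x)}R_d^{-1}$ for $\alpha_x\in T^*_xTQ$, $x\in V$, and let $R_d^{T^*}=\Phi^{-1}\circ\widehat{R_d}\circ\alpha_Q$ be the cotangent lift; it is a bijection from $\{v\in TT^*Q: T\pi_Q(v)\in V\}$ onto $\{(\alpha_{q_0},\alpha_{q_1})\in T^*Q\times T^*Q:(q_0,q_1)\in R_d(V)\}$. The pairing $\langle v,u\rangle^T\in\mathbb R$ of $v\in TT^*Q$ and $u\in TTQ$ with $T\pi_Q(v)=T\tau_Q(u)$ is $$\langle v,u\rangle^T=\frac{d}{dt}\Big|_{t=0}\langle\sigma(t),\gamma(t)\rangle ,$$ for any smooth curves $\sigma$ in $T^*Q$ and $\gamma$ in $TQ$ with $\pi_Q\circ\sigma=\tau_Q\circ\gamma$ near $0$, $\dot\sigma(0)=v$, $\dot\gamma(0)=u$. Proposition. Let $R_d:U\to Q\times Q$ be a discretization map and let $V\subset U$ be any open set which $R_d$ maps diffeomorphically onto an open subset of $Q\times Q$. Let $\alpha_{q_0}\in T^*_{q_0}Q$, $\alpha_{q_1}\in T^*_{q_1}Q$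 with $(q_0,q_1)\in R_d(V)$, and let $w\in TTQ$ satisfy $R_d^{-1}(q_0,q_1)=T\tau_Q(w)$. Then the pairing $\langle (R_d^{T^*})^{-1}(\alpha_{q_0},\alpha_{q_1}),w\rangle^T$ is well defined (curves as above exist and all give the same value), and $$\big\langle\Phi(\alpha_{q_0},\alpha_{q_1}),R_d^T(w)\big\rangle=\big\langle (R_d^{T^*})^{-1}(\alpha_{q_0},\alpha_{q_1}),\,w\big\rangle^T .$$ -/

import Mathlib

open Bundle Set Filter Topology
open scoped Manifold ContDiff

noncomputable section

namespace DiscretizationMap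

section Cotangent

variable {E : Type*} [NormedAddCommGroup E] [NormedSpace ℝ E]
  {H : Type*} [TopologicalSpace H] (I : ModelWithCorners ℝ E H)
  (M : Type*) [TopologicalSpace M] [ChartedSpace H M]

/-- The cotangent bundle `T*M`: the bundle over `M` whose fibre at `x` is the continuous dual of
`T_x M`. Its topology and smooth structure are Mathlib's for the bundle of continuous linear maps
from the tangent bundle to the trivial line bundle. -/
abbrev CotangentBundle : Type _ :=
  TotalSpace (E →L[ℝ] ℝ) (fun x : M ↦ TangentSpace I x →L[ℝ] Bundle.Trivial M ℝ x)

/-- The model with corners of `T*M` over a manifold `M` modelled with `I`. -/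
abbrev cotangentModel : ModelWithCorners ℝ (E × (E →L[ℝ] ℝ)) (ModelProd H (E →L[ℝ] ℝ)) :=
  I.prod 𝓘(ℝ, E →L[ℝ] ℝ)

variable {I M}

open Classical in
/-- The canonical pairing `⟨α, u⟩` of a covector `α ∈ T*_x M` with a vector `u ∈ T_x M` at the
same point (and the dummy value `0` when the base points differ). -/
def canonicalPairing (α : CotangentBundle I M) (u : TangentBundle I M) : ℝ :=
  if h : u.proj = α.proj then
    (α.2 : TangentSpace I α.proj →L[ℝ] ℝ) (cast (congrArg (TangentSpace I (M := M)) h) u.2)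
  else 0

/-- The velocity at time `0` of a curve in `M`, as a point of `TM`. -/
def velocity (I : ModelWithCorners ℝ E H) (c : ℝ → M) : TangentBundle I M :=
  tangentMap 𝓘(ℝ, ℝ) I c ⟨0, (1 : ℝ)⟩

end Cotangent

section CotangentLift

variable {E : Type*} [NormedAddCommGroup E] [NormedSpace ℝ E]
  {H : Type*} [TopologicalSpace H] {I : ModelWithCorners ℝ E H}
  {M : Type*} [TopologicalSpace M] [ChartedSpace H M]
  {E' : Type*} [NormedAddCommGroup E'] [NormedSpace ℝ E']
  {H' : Type*} [TopologicalSpace H'] {J : ModelWithCorners ℝ E' H'}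
  {N : Type*} [TopologicalSpace N] [ChartedSpace H' N]

/-- The fibrewise map `T*G : T*M → T*N`, for a map `G : N → M` with inverse `F : M → N`:
it sends `α ∈ T*_x M` to `α ∘ T_{F x} G ∈ T*_{F x} N`. -/
def cotangentMap (F : M → N) (G : N → M) (α : CotangentBundle I M) : CotangentBundle J N :=
  ⟨F α.proj, (α.2 : E →L[ℝ] ℝ).comp (mfderiv J I G (F α.proj) : E' →L[ℝ] E)⟩

theorem cotangentMap_leftInv (F : PartialDiffeomorph I J M N ∞) (α : CotangentBundle I M)
    (hα : α.proj ∈ F.source) :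
    cotangentMap (I := J) (J := I) F.symm F (cotangentMap (J := J) F F.symm α) = α := by
  obtain ⟨x, p⟩ := α
  have hx : F.symm (F x) = x := F.left_inv hα
  have hFx : F x ∈ F.target := F.map_source hα
  have h1 : HasMFDerivAt I J F x (mfderiv I J F x) :=
    ((F.contMDiffOn_toFun.contMDiffAt (F.open_source.mem_nhds hα)).mdifferentiableAt
      (by simp)).hasMFDerivAt
  have h2 : HasMFDerivAt J I F.symm (F x) (mfderiv J I F.symm (F x)) :=
    ((F.contMDiffOn_invFun.contMDiffAt (F.open_target.mem_nhds hFx)).mdifferentiableAt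
      (by simp)).hasMFDerivAt
  have h3 := h2.comp x h1
  have h4 : HasMFDerivAt I I (F.symm ∘ F) x (ContinuousLinearMap.id ℝ (TangentSpace I x)) := by
    refine (hasMFDerivAt_id x).congr_of_eventuallyEq ?_
    filter_upwards [F.open_source.mem_nhds hα] with y hy using F.left_inv hy
  have h5 := hasMFDerivAt_unique h3 h4
  unfold cotangentMap
  refine TotalSpace.ext hx (heq_of_eq ?_)
  change ((p : E →L[ℝ] ℝ).comp (mfderiv J I F.symm (F x) : E' →L[ℝ] E)).comp
    (mfderiv I J F (F.symm (F x)) : E →L[ℝ] E') = (p : E →L[ℝ] ℝ)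
  rw [hx]
  refine ContinuousLinearMap.ext fun a ↦ ?_
  exact congrArg (p : E →L[ℝ] ℝ) (DFunLike.congr_fun h5 a)

/-- For a diffeomorphism `F` from an open subset of `M` onto an open subset of `N`, the map
`F̂ = T*(F⁻¹)`, `α_x ↦ α_x ∘ T_{F x}(F⁻¹)`, from the covectors over the domain of `F` onto the
covectors over its image. Its inverse is `T*F`. -/
def cotangentLiftOfDiffeo (F : PartialDiffeomorph I J M N ∞) :
    PartialEquiv (CotangentBundle I M) (CotangentBundle J N) where
  toFun := cotangentMap F F.symm
  invFun := cotangentMap F.symm F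
  source := {α | α.proj ∈ F.source}
  target := {β | β.proj ∈ F.target}
  map_source' _ hα := F.map_source hα
  map_target' _ hβ := F.map_target hβ
  left_inv' α hα := cotangentMap_leftInv F α hα
  right_inv' β hβ := cotangentMap_leftInv F.symm β hβ

end CotangentLift

section Lifts

variable {E : Type*} [NormedAddCommGroup E] [NormedSpace ℝ E]
  {H : Type*} [TopologicalSpace H] {I : ModelWithCorners ℝ E H}
  {Q : Type*} [TopologicalSpace Q] [ChartedSpace H Q]

/-- The tangent map at `0_x` of the restriction of `f : TQ → Q` to `T_x Q`, as an endomorphism of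
`T_x Q`, for a map `f` with `f(0_x) = x`; here `T_{0_x} T_x Q` is identified with `T_x Q`. -/
def fibreDeriv (f : TangentBundle I Q → Q) (x : Q) : TangentSpace I x →L[ℝ] TangentSpace I x :=
  (mfderiv 𝓘(ℝ, E) I (fun v : E ↦ f ⟨x, v⟩) 0 : E →L[ℝ] E)

/-- `R = (R¹, R²) : U ⊆ TQ → Q × Q` is a (smooth) discretization map on `Q`: `U` is an open
neighbourhood of the zero section, `R(x, 0) = (x, x)`, and the derivative at `0_x` of
`R²_x - R¹_x` is the identity of `T_x Q`. (The values of `R` outside `U` are irrelevant.) -/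
structure IsDiscretizationMap [IsManifold I ∞ Q] (U : Set (TangentBundle I Q))
    (R : TangentBundle I Q → Q × Q) : Prop where
  isOpen : IsOpen U
  zero_mem : ∀ x : Q, (⟨x, (0 : E)⟩ : TangentBundle I Q) ∈ U
  smooth : ContMDiffOn I.tangent (I.prod I) ∞ R U
  map_zero : ∀ x : Q, R ⟨x, (0 : E)⟩ = (x, x)
  deriv_sub : ∀ x : Q, fibreDeriv (fun z ↦ (R z).2) x - fibreDeriv (fun z ↦ (R z).1) x
    = ContinuousLinearMap.id ℝ (TangentSpace I x)

/-- The canonical involution `κ_Q : TTQ → TTQ`, `(q, v, q̇, v̇) ↦ (q, q̇, v, v̇)`.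

The coordinates are those induced on `TTQ` by the preferred chart of `Q` at `q`: in Mathlib a
tangent vector of `TQ` at `(q, v)` is the element `(q̇, v̇)` of `E × E` which represents it in the
preferred chart of `TQ` at `(q, v)`, and that chart is the one induced by the preferred chart of
`Q` at `q`. -/
def canonicalInvolution [IsManifold I ∞ Q]
    (z : TangentBundle I.tangent (TangentBundle I Q)) :
    TangentBundle I.tangent (TangentBundle I Q) :=
  ⟨⟨z.proj.proj, (z.2 : E × E).1⟩, ((z.proj.2 : E), (z.2 : E × E).2)⟩

/-- The canonical isomorphism `α_Q : TT*Q → T*TQ`, `(q, p, q̇, ṗ) ↦ (q, q̇, ṗ, p)`; that is, the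
image is the covector `(a, b) ↦ ṗ(a) + p(b)` at the point `(q, q̇)` of `TQ`. As for the canonical
involution, the coordinates are those induced by the preferred chart of `Q` at `q`. -/
def tulczyjewEquiv [IsManifold I ∞ Q] :
    TangentBundle (cotangentModel I) (CotangentBundle I Q) ≃
      CotangentBundle I.tangent (TangentBundle I Q) where
  toFun v :=
    ⟨⟨v.proj.proj, (v.2 : E × (E →L[ℝ] ℝ)).1⟩,
      ((v.2 : E × (E →L[ℝ] ℝ)).2.coprod (v.proj.2 : E →L[ℝ] ℝ) : E × E →L[ℝ] ℝ)⟩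
  invFun β :=
    ⟨⟨β.proj.proj, (β.2 : E × E →L[ℝ] ℝ).comp (ContinuousLinearMap.inr ℝ E E)⟩,
      ((β.proj.2 : E), (β.2 : E × E →L[ℝ] ℝ).comp (ContinuousLinearMap.inl ℝ E E))⟩
  left_inv v := by
    obtain ⟨⟨q, p⟩, w⟩ := v
    exact congrArg₂ (fun a b : E →L[ℝ] ℝ ↦
      (⟨⟨q, a⟩, ((w : E × (E →L[ℝ] ℝ)).1, b)⟩ :
        TangentBundle (cotangentModel I) (CotangentBundle I Q)))
      (ContinuousLinearMap.coprod_comp_inr (w : E × (E →L[ℝ] ℝ)).2 (p : E →L[ℝ] ℝ))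
      (ContinuousLinearMap.coprod_comp_inl (w : E × (E →L[ℝ] ℝ)).2 (p : E →L[ℝ] ℝ))
  right_inv β := by
    obtain ⟨⟨q, u⟩, b⟩ := β
    refine TotalSpace.ext rfl (heq_of_eq ?_)
    exact ContinuousLinearMap.coprod_comp_inl_inr (b : E × E →L[ℝ] ℝ)

/-- The diffeomorphism `Φ : T*Q × T*Q → T*(Q × Q)`, `(α₀, α₁) ↦ (-α₀, α₁)`. -/
def signedProdEquiv :
    CotangentBundle I Q × CotangentBundle I Q ≃ CotangentBundle (I.prod I) (Q × Q) where
  toFun α := ⟨(α.1.proj, α.2.proj),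
    ((-(α.1.2 : E →L[ℝ] ℝ)).coprod (α.2.2 : E →L[ℝ] ℝ) : E × E →L[ℝ] ℝ)⟩
  invFun β :=
    (⟨β.proj.1, -((β.2 : E × E →L[ℝ] ℝ).comp (ContinuousLinearMap.inl ℝ E E))⟩,
      ⟨β.proj.2, (β.2 : E × E →L[ℝ] ℝ).comp (ContinuousLinearMap.inr ℝ E E)⟩)
  left_inv α := by
    obtain ⟨⟨q, p⟩, ⟨q', p'⟩⟩ := α
    exact congrArg₂ (fun a b : E →L[ℝ] ℝ ↦
      ((⟨q, a⟩, ⟨q', b⟩) : CotangentBundle I Q × CotangentBundle I Q))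
      ((congrArg Neg.neg (ContinuousLinearMap.coprod_comp_inl (-(p : E →L[ℝ] ℝ))
        (p' : E →L[ℝ] ℝ))).trans (neg_neg _))
      (ContinuousLinearMap.coprod_comp_inr (-(p : E →L[ℝ] ℝ)) (p' : E →L[ℝ] ℝ))
  right_inv β := by
    obtain ⟨q, b⟩ := β
    refine TotalSpace.ext rfl (heq_of_eq ?_)
    change (- -((b : E × E →L[ℝ] ℝ).comp (ContinuousLinearMap.inl ℝ E E))).coprod
      ((b : E × E →L[ℝ] ℝ).comp (ContinuousLinearMap.inr ℝ E E)) = (b : E × E →L[ℝ] ℝ)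
    rw [neg_neg]
    exact ContinuousLinearMap.coprod_comp_inl_inr (b : E × E →L[ℝ] ℝ)

/-- The tangent lift `R^T = TR ∘ κ_Q` of `R : TQ → Q × Q`, with `T(Q × Q)` identified with
`TQ × TQ`. -/
def tangentLift [IsManifold I ∞ Q] (R : TangentBundle I Q → Q × Q)
    (w : TangentBundle I.tangent (TangentBundle I Q)) :
    TangentBundle I Q × TangentBundle I Q :=
  equivTangentBundleProd I Q I Q (tangentMap I.tangent (I.prod I) R (canonicalInvolution w))

/-- The cotangent lift `R^{T*} = Φ⁻¹ ∘ R̂ ∘ α_Q` of a diffeomorphism `R` from an open subset `V`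
of `TQ` onto an open subset of `Q × Q`, as a bijection from the set of the `v ∈ TT*Q` with
`Tπ_Q(v) ∈ V` onto the set of the `(α₀, α₁) ∈ T*Q × T*Q` with base points in `R(V)`. -/
def cotangentLift [IsManifold I ∞ Q]
    (R : PartialDiffeomorph I.tangent (I.prod I) (TangentBundle I Q) (Q × Q) ∞) :
    PartialEquiv (TangentBundle (cotangentModel I) (CotangentBundle I Q))
      (CotangentBundle I Q × CotangentBundle I Q) :=
  (tulczyjewEquiv.toPartialEquiv.trans (cotangentLiftOfDiffeo R)).trans
    signedProdEquiv.symm.toPartialEquiv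

/-- Curves `σ` in `T*Q` and `γ` in `TQ`, smooth and over the same curve of `Q` near time `0`,
with velocities `v ∈ TT*Q` and `u ∈ TTQ` at time `0`. -/
structure AdaptedCurves [IsManifold I ∞ Q]
    (v : TangentBundle (cotangentModel I) (CotangentBundle I Q))
    (u : TangentBundle I.tangent (TangentBundle I Q))
    (σ : ℝ → CotangentBundle I Q) (γ : ℝ → TangentBundle I Q) : Prop where
  smooth_left : ContMDiffAt 𝓘(ℝ, ℝ) (cotangentModel I) ∞ σ 0
  smooth_right : ContMDiffAt 𝓘(ℝ, ℝ) I.tangent ∞ γ 0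
  proj_eq : ∀ᶠ t in 𝓝 0, (σ t).proj = (γ t).proj
  velocity_left : velocity (cotangentModel I) σ = v
  velocity_right : velocity I.tangent γ = u

/-- `⟨v, u⟩^T` is defined and equal to `r`: there are adapted curves for `v ∈ TT*Q` and `u ∈ TTQ`,
and `d/dt ⟨σ(t), γ(t)⟩ = r` at `t = 0` for all of them. -/
def HasTangentPairing [IsManifold I ∞ Q]
    (v : TangentBundle (cotangentModel I) (CotangentBundle I Q))
    (u : TangentBundle I.tangent (TangentBundle I Q)) (r : ℝ) : Prop :=
  (∃ σ γ, AdaptedCurves v u σ γ) ∧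
    ∀ σ γ, AdaptedCurves v u σ γ → HasDerivAt (fun t ↦ canonicalPairing (σ t) (γ t)) r 0

open Classical in
/-- The pairing `⟨v, u⟩^T` of `v ∈ TT*Q` with `u ∈ TTQ` (and the dummy value `0` when it is not
defined, which happens if `Tπ_Q(v) ≠ Tτ_Q(u)`). -/
def tangentPairing [IsManifold I ∞ Q]
    (v : TangentBundle (cotangentModel I) (CotangentBundle I Q))
    (u : TangentBundle I.tangent (TangentBundle I Q)) : ℝ :=
  if h : ∃ r, HasTangentPairing v u r then h.choose else 0

end Lifts

end DiscretizationMap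

end

noncomputable section

namespace DiscretizationMap

section Curves

variable {E : Type*} [NormedAddCommGroup E] [NormedSpace ℝ E]
  {H : Type*} [TopologicalSpace H] {I : ModelWithCorners ℝ E H}
  {M : Type*} [TopologicalSpace M] [ChartedSpace H M]

/-- The velocity of a curve, read in the preferred chart at its base point. -/
theorem hasDerivAt_extChartAt_comp {c : ℝ → M} (hc : MDifferentiableAt 𝓘(ℝ, ℝ) I c 0) :
    HasDerivAt (fun t ↦ extChartAt I (c 0) (c t)) ((velocity I c).2 : E) 0 := by
  have h := hc.hasMFDerivAt.2
  simp only [mfld_simps] at h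
  have key (L : ℝ →L[ℝ] E)
      (hL : HasFDerivWithinAt (fun t ↦ extChartAt I (c 0) (c t)) L univ 0) :
      HasDerivAt (fun t ↦ extChartAt I (c 0) (c t)) (L 1) 0 :=
    (hasFDerivWithinAt_univ.1 hL).hasDerivAt
  exact key _ h

/-- The curve through `x` which is affine in the preferred chart at `x`. -/
def chartLine (I : ModelWithCorners ℝ E H) (x : M) (X : E) (t : ℝ) : M :=
  (extChartAt I x).symm (extChartAt I x x + t • X)

theorem chartLine_zero (x : M) (X : E) : chartLine I x X 0 = x := by
  simp [chartLine]

theorem contDiff_line (a X : E) : ContDiff ℝ ∞ (fun t : ℝ ↦ a + t • X) := by fun_prop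

theorem eventually_line_mem_target [I.Boundaryless] (x : M) (X : E) :
    ∀ᶠ t : ℝ in 𝓝 0, extChartAt I x x + t • X ∈ (extChartAt I x).target := by
  have h : ContinuousAt (fun t : ℝ ↦ extChartAt I x x + t • X) 0 :=
    (contDiff_line _ X).continuous.continuousAt
  refine h.eventually_mem ?_
  simpa using extChartAt_target_mem_nhds (I := I) x

theorem contMDiffAt_chartLine [I.Boundaryless] [IsManifold I ∞ M] (x : M) (X : E) :
    ContMDiffAt 𝓘(ℝ, ℝ) I ∞ (chartLine I x X) 0 := by
  have h1 : ContMDiffAt 𝓘(ℝ, ℝ) 𝓘(ℝ, E) ∞ (fun t : ℝ ↦ extChartAt I x x + t • X) 0 :=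
    (contDiff_line _ X).contMDiff.contMDiffAt
  refine ContMDiffAt.comp (g := (extChartAt I x).symm) (0 : ℝ) ?_ h1
  refine (contMDiffOn_extChartAt_symm x).contMDiffAt ?_
  simpa using extChartAt_target_mem_nhds (I := I) x

theorem velocity_chartLine [I.Boundaryless] [IsManifold I ∞ M] (x : M) (X : E) :
    velocity I (chartLine I x X) = ⟨x, X⟩ := by
  have h0 := chartLine_zero (I := I) x X
  have h := hasDerivAt_extChartAt_comp
    ((contMDiffAt_chartLine (I := I) x X).mdifferentiableAt (by simp))
  rw [h0] at h
  have h' : HasDerivAt (fun t ↦ extChartAt I x (chartLine I x X t)) X 0 := by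
    have : HasDerivAt (fun t : ℝ ↦ extChartAt I x x + t • X) X 0 := by
      simpa using ((hasDerivAt_id (0 : ℝ)).smul_const X).const_add (extChartAt I x x)
    refine this.congr_of_eventuallyEq ?_
    filter_upwards [eventually_line_mem_target (I := I) x X] with t ht
    exact (extChartAt I x).right_inv ht
  exact TotalSpace.ext h0 (heq_of_eq (h.unique h'))

end Curves

section Projection

variable {E : Type*} [NormedAddCommGroup E] [NormedSpace ℝ E]
  {H : Type*} [TopologicalSpace H] {I : ModelWithCorners ℝ E H}
  {M : Type*} [TopologicalSpace M] [ChartedSpace H M]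
  {F : Type*} [NormedAddCommGroup F] [NormedSpace ℝ F] {V : M → Type*}
  [TopologicalSpace (TotalSpace F V)] [∀ x, TopologicalSpace (V x)] [FiberBundle F V]

theorem proj_extChartAt_symm (z : TotalSpace F V) {y : E × F}
    (hy : y ∈ (extChartAt (I.prod 𝓘(ℝ, F)) z).target) :
    ((extChartAt (I.prod 𝓘(ℝ, F)) z).symm y).proj = (extChartAt I z.proj).symm y.1 := by
  rw [FiberBundle.extChartAt_target] at hy
  rw [FiberBundle.extChartAt]
  exact Trivialization.proj_symm_apply _ ((Trivialization.mem_target _).2 hy.1.2)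

theorem extChartAt_self_fst (z : TotalSpace F V) :
    (extChartAt (I.prod 𝓘(ℝ, F)) z z).1 = extChartAt I z.proj z.proj := by
  rw [FiberBundle.extChartAt]
  simp

theorem hasMFDerivAt_proj (z : TotalSpace F V) :
    HasMFDerivAt (I.prod 𝓘(ℝ, F)) I (TotalSpace.proj : TotalSpace F V → M) z
      (ContinuousLinearMap.fst ℝ E F) := by
  refine ⟨(FiberBundle.continuous_proj F V).continuousAt, ?_⟩
  refine HasFDerivWithinAt.congr_of_eventuallyEq (f := Prod.fst)
    (ContinuousLinearMap.fst ℝ E F).hasFDerivWithinAt ?_ ?_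
  swap
  · simp only [writtenInExtChartAt, Function.comp_apply, extChartAt_to_inv]
    exact (extChartAt_self_fst z).symm
  filter_upwards [extChartAt_target_mem_nhdsWithin (I := I.prod 𝓘(ℝ, F)) z] with y hy
  have hy' := hy
  rw [FiberBundle.extChartAt_target] at hy'
  simp only [writtenInExtChartAt, Function.comp_apply]
  rw [proj_extChartAt_symm z hy]
  exact (extChartAt I z.proj).right_inv hy'.1.1

end Projection

section Pairing

variable {E : Type*} [NormedAddCommGroup E] [NormedSpace ℝ E]
  {H : Type*} [TopologicalSpace H] {I : ModelWithCorners ℝ E H}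
  {Q : Type*} [TopologicalSpace Q] [ChartedSpace H Q] [IsManifold I ∞ Q]

theorem tangentMap_proj (w : TangentBundle I.tangent (TangentBundle I Q)) :
    tangentMap I.tangent I (TotalSpace.proj : TangentBundle I Q → Q) w =
      ⟨w.proj.proj, (w.2 : E × E).1⟩ := by
  have h := (hasMFDerivAt_proj (I := I) (F := E) (V := TangentSpace I) w.proj).mfderiv
  refine TotalSpace.ext rfl (heq_of_eq ?_)
  exact DFunLike.congr_fun h w.2

omit [IsManifold I ∞ Q] in
theorem canonicalPairing_mk (q : Q) (p : E →L[ℝ] ℝ) (x : E) :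
    canonicalPairing (⟨q, p⟩ : CotangentBundle I Q) (⟨q, x⟩ : TangentBundle I Q) = p x := by
  simp [canonicalPairing]; rfl

/-- The pairing is preserved by the trivializations of `T*Q` and `TQ` over a chart domain. -/
theorem canonicalPairing_eq_trivializationAt (q : Q) {α : CotangentBundle I Q}
    {u : TangentBundle I Q} (h : α.proj = u.proj) (hq : u.proj ∈ (chartAt H q).source) :
    canonicalPairing α u =
      (trivializationAt (E →L[ℝ] ℝ)
        (fun x : Q ↦ TangentSpace I x →L[ℝ] Bundle.Trivial Q ℝ x) q α).2
        (trivializationAt E (TangentSpace I) q u).2 := by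
  obtain ⟨y, p : E →L[ℝ] ℝ⟩ := α
  obtain ⟨y', x : E⟩ := u
  obtain rfl : y = y' := h
  refine (canonicalPairing_mk y p x).trans ?_
  rw [hom_trivializationAt_apply]
  have hb : y ∈ (trivializationAt E (TangentSpace I) q).baseSet := hq
  have hx (x : TangentSpace I y) : (trivializationAt E (TangentSpace I) q).symmL ℝ y
      (trivializationAt E (TangentSpace I) q ⟨y, x⟩).2 = x := by
    rw [← Trivialization.continuousLinearMapAt_apply_of_mem (R := ℝ) _ hb]
    exact Trivialization.symmL_continuousLinearMapAt _ hb x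
  simp only [ContinuousLinearMap.inCoordinates, Trivial.eq_trivialization,
    Trivial.continuousLinearMapAt_trivialization]
  exact congrArg p (hx x).symm

theorem trivializationAt_tangent_self (u : TangentBundle I Q) :
    (trivializationAt E (TangentSpace I) u.proj u).2 = u.2 := by
  rw [TangentBundle.trivializationAt_apply]
  exact tangentCoordChange_self (mem_extChartAt_source _)

theorem trivializationAt_cotangent_self (α : CotangentBundle I Q) :
    (trivializationAt (E →L[ℝ] ℝ)
      (fun x : Q ↦ TangentSpace I x →L[ℝ] Bundle.Trivial Q ℝ x) α.proj α).2 = α.2 := by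
  obtain ⟨q, p : E →L[ℝ] ℝ⟩ := α
  refine ContinuousLinearMap.ext fun x : E ↦ ?_
  have h := canonicalPairing_eq_trivializationAt q (α := (⟨q, p⟩ : CotangentBundle I Q))
    (u := (⟨q, x⟩ : TangentBundle I Q)) rfl (mem_chart_source _ _)
  have hx := trivializationAt_tangent_self (⟨q, x⟩ : TangentBundle I Q)
  rw [hx] at h
  exact h.symm.trans (canonicalPairing_mk q p x)

theorem AdaptedCurves.hasDerivAt {v : TangentBundle (cotangentModel I) (CotangentBundle I Q)}
    {u : TangentBundle I.tangent (TangentBundle I Q)}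
    {σ : ℝ → CotangentBundle I Q} {γ : ℝ → TangentBundle I Q} (h : AdaptedCurves v u σ γ) :
    HasDerivAt (fun t ↦ canonicalPairing (σ t) (γ t))
      ((v.2 : E × (E →L[ℝ] ℝ)).2 (u.proj.2 : E) +
        (v.proj.2 : E →L[ℝ] ℝ) (u.2 : E × E).2) 0 := by
  obtain ⟨hσ, hγ, hp, rfl, rfl⟩ := h
  have h0 : (σ 0).proj = (γ 0).proj := hp.self_of_nhds
  have dσ := (hasDerivAt_extChartAt_comp (hσ.mdifferentiableAt (by simp))).snd
  have dγ := (hasDerivAt_extChartAt_comp (hγ.mdifferentiableAt (by simp))).snd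
  simp only [FiberBundle.extChartAt] at dσ dγ
  have hmem : ∀ᶠ t in 𝓝 (0 : ℝ), (γ t).proj ∈ (chartAt H (σ 0).proj).source := by
    have hc : ContinuousAt (fun t ↦ (γ t).proj) 0 :=
      (FiberBundle.continuous_proj E (TangentSpace I)).continuousAt.comp hγ.continuousAt
    refine hc.eventually_mem ((chartAt H (σ 0).proj).open_source.mem_nhds ?_)
    rw [h0]
    exact mem_chart_source _ _
  have dσ' : HasDerivAt (fun t ↦ (trivializationAt (E →L[ℝ] ℝ)
        (fun x : Q ↦ TangentSpace I x →L[ℝ] Bundle.Trivial Q ℝ x) (σ 0).proj (σ t)).2)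
      ((velocity (cotangentModel I) σ).2 : E × (E →L[ℝ] ℝ)).2 0 := dσ
  have dγ' : HasDerivAt (fun t ↦ (trivializationAt E (TangentSpace I) (γ 0).proj (γ t)).2)
      ((velocity I.tangent γ).2 : E × E).2 0 := dγ
  have d := dσ'.clm_apply dγ'
  rw [trivializationAt_cotangent_self, trivializationAt_tangent_self] at d
  refine d.congr_of_eventuallyEq ?_
  filter_upwards [hp, hmem] with t ht hm
  rw [← h0]
  exact canonicalPairing_eq_trivializationAt _ ht hm

theorem exists_adaptedCurves [I.Boundaryless]
    (q : Q) (p : E →L[ℝ] ℝ) (x : E) (a : E) (b : E →L[ℝ] ℝ) (c : E) :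
    ∃ σ γ, AdaptedCurves
      (⟨⟨q, p⟩, (a, b)⟩ : TangentBundle (cotangentModel I) (CotangentBundle I Q))
      (⟨⟨q, x⟩, (a, c)⟩ : TangentBundle I.tangent (TangentBundle I Q)) σ γ := by
  refine ⟨chartLine (cotangentModel I) (⟨q, p⟩ : CotangentBundle I Q) (a, b),
    chartLine I.tangent (⟨q, x⟩ : TangentBundle I Q) (a, c),
    contMDiffAt_chartLine _ _, contMDiffAt_chartLine _ _, ?_,
    velocity_chartLine _ _, velocity_chartLine _ _⟩
  filter_upwards [eventually_line_mem_target (I := cotangentModel I)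
      (⟨q, p⟩ : CotangentBundle I Q) (a, b),
    eventually_line_mem_target (I := I.tangent) (⟨q, x⟩ : TangentBundle I Q) (a, c)] with t h1 h2
  refine (proj_extChartAt_symm _ h1).trans (Eq.trans ?_ (proj_extChartAt_symm _ h2).symm)
  exact congrArg (fun y ↦ (extChartAt I q).symm (y + t • a))
    ((extChartAt_self_fst (⟨q, p⟩ : CotangentBundle I Q)).trans
      (extChartAt_self_fst (⟨q, x⟩ : TangentBundle I Q)).symm)

theorem HasTangentPairing.tangentPairing_eq
    {v : TangentBundle (cotangentModel I) (CotangentBundle I Q)}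
    {u : TangentBundle I.tangent (TangentBundle I Q)} {r : ℝ} (h : HasTangentPairing v u r) :
    tangentPairing v u = r := by
  have hex : ∃ r, HasTangentPairing v u r := ⟨r, h⟩
  obtain ⟨σ, γ, hσγ⟩ := h.1
  rw [tangentPairing, dif_pos hex]
  exact (hex.choose_spec.2 σ γ hσγ).unique (h.2 σ γ hσγ)

/-- In induced coordinates, the pairing of `(q, p, a, b) ∈ TT*Q` with `(q, x, a, c) ∈ TTQ` is
`b(x) + p(c)`. -/
theorem hasTangentPairing_mk [I.Boundaryless]
    (q : Q) (p : E →L[ℝ] ℝ) (x : E) (a : E) (b : E →L[ℝ] ℝ) (c : E) :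
    HasTangentPairing
      (⟨⟨q, p⟩, (a, b)⟩ : TangentBundle (cotangentModel I) (CotangentBundle I Q))
      (⟨⟨q, x⟩, (a, c)⟩ : TangentBundle I.tangent (TangentBundle I Q)) (b x + p c) :=
  ⟨exists_adaptedCurves q p x a b c, fun _ _ h ↦ h.hasDerivAt⟩

end Pairing

end DiscretizationMap

end
theorem mainTheorem7
    {E : Type*} [NormedAddCommGroup E] [NormedSpace ℝ E] [FiniteDimensional ℝ E]
    {H : Type*} [TopologicalSpace H] (I : ModelWithCorners ℝ E H) [I.Boundaryless]
    {Q : Type*} [TopologicalSpace Q] [ChartedSpace H Q] [IsManifold I ∞ Q]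
    (U : Set (TangentBundle I Q)) (R : TangentBundle I Q → Q × Q)
    (hR : DiscretizationMap.IsDiscretizationMap U R)
    (F : PartialDiffeomorph I.tangent (I.prod I) (TangentBundle I Q) (Q × Q) ∞)
    (hFU : F.source ⊆ U) (hF : Set.EqOn F R F.source)
    (α₀ α₁ : DiscretizationMap.CotangentBundle I Q) (hα : (α₀.proj, α₁.proj) ∈ F.target)
    (w : TangentBundle I.tangent (TangentBundle I Q))
    (hw : F.symm (α₀.proj, α₁.proj) =
      tangentMap I.tangent I (TotalSpace.proj : TangentBundle I Q → Q) w) :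
    DiscretizationMap.HasTangentPairing
        ((DiscretizationMap.cotangentLift F).symm (α₀, α₁)) w
        (DiscretizationMap.tangentPairing
          ((DiscretizationMap.cotangentLift F).symm (α₀, α₁)) w) ∧
      DiscretizationMap.canonicalPairing (DiscretizationMap.signedProdEquiv (α₀, α₁))
          ((equivTangentBundleProd I Q I Q).symm (DiscretizationMap.tangentLift R w)) =
        DiscretizationMap.tangentPairing
          ((DiscretizationMap.cotangentLift F).symm (α₀, α₁)) w := by
  obtain ⟨⟨q, x : E⟩, ⟨a, c⟩⟩ := w
  rw [DiscretizationMap.tangentMap_proj] at hw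
  change F.symm (α₀.proj, α₁.proj) = (⟨q, a⟩ : TangentBundle I Q) at hw
  set v := (DiscretizationMap.cotangentLift F).symm (α₀, α₁) with hv
  set B : E × E →L[ℝ] ℝ := (-(α₀.2 : E →L[ℝ] ℝ)).coprod (α₁.2 : E →L[ℝ] ℝ) with hB
  set A : E × E →L[ℝ] E × E := mfderiv I.tangent (I.prod I) F (⟨q, a⟩ : TangentBundle I Q) with hA
  have hv' : v = ⟨⟨q, (B.comp A).comp (ContinuousLinearMap.inr ℝ E E)⟩,
      (a, (B.comp A).comp (ContinuousLinearMap.inl ℝ E E))⟩ := by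
    have h1 : DiscretizationMap.cotangentMap (I := I.prod I) (J := I.tangent) F.symm F
        (DiscretizationMap.signedProdEquiv (α₀, α₁)) = ⟨⟨q, a⟩, B.comp A⟩ := by
      refine TotalSpace.ext hw (heq_of_eq ?_)
      rw [hA, ← hw]
      rfl
    exact congrArg DiscretizationMap.tulczyjewEquiv.symm h1
  have key : DiscretizationMap.HasTangentPairing v
      (⟨⟨q, x⟩, (a, c)⟩ : TangentBundle I.tangent (TangentBundle I Q)) (B (A (x, c))) := by
    have hval : (B.comp A).comp (ContinuousLinearMap.inl ℝ E E) x +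
        (B.comp A).comp (ContinuousLinearMap.inr ℝ E E) c = B (A (x, c)) := by
      change B (A (x, 0)) + B (A (0, c)) = _
      rw [← map_add, ← map_add, Prod.mk_add_mk, add_zero, zero_add]
    rw [hv', ← hval]
    exact DiscretizationMap.hasTangentPairing_mk (I := I) q _ x a _ c
  rw [key.tangentPairing_eq]
  refine ⟨key, ?_⟩
  have hmem : (⟨q, a⟩ : TangentBundle I Q) ∈ F.source := hw ▸ F.map_target hα
  have hFq : R (⟨q, a⟩ : TangentBundle I Q) = (α₀.proj, α₁.proj) := by
    rw [← hF hmem, ← hw]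
    exact F.right_inv hα
  have hRA : (mfderiv I.tangent (I.prod I) R (⟨q, a⟩ : TangentBundle I Q) :
      E × E →L[ℝ] E × E) = A :=
    (hF.eventuallyEq_of_mem (F.open_source.mem_nhds hmem)).symm.mfderiv_eq
  have hT : tangentMap I.tangent (I.prod I) R (DiscretizationMap.canonicalInvolution
      (⟨⟨q, x⟩, (a, c)⟩ : TangentBundle I.tangent (TangentBundle I Q))) =
        ⟨(α₀.proj, α₁.proj), A (x, c)⟩ := by
    refine TotalSpace.ext hFq (heq_of_eq ?_)
    exact DFunLike.congr_fun hRA (x, c)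
  rw [DiscretizationMap.tangentLift, Equiv.symm_apply_apply, hT]
  exact DiscretizationMap.canonicalPairing_mk (I := I.prod I) (α₀.proj, α₁.proj) B (A (x, c))
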